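/- **Setting.** Let $V$ be a finite vertex set with $n=|V|$, with a distinguished vertex $0\in V$, and let $H=(V,E,w)$ be a finite directed hypergraph: each $e\in E$ has a nonempty tail $\mathsf T_e\subseteq V$, a nonempty head $\mathsf H_e\subseteq V$ and a weight $w_e\ge 0$. Let $\kappa\ge 1$, let the vertex weights $\omega:V\to\mathbb R$ satisfy $1\le\omega_i\le\kappa$ for all $i$, and put $W=\sum_{i\in V}\omega_i$. For matrices in $\mathbb R^{V\times V}$ write $A\bullet B=\mathrm{Tr}(A^{\mathsf T}B)$. With $L_{ij}=(e_i-e_j)(e_i-e_j)^{\mathsf T}$ (so that $L_{ij}\bullet X=\|v_i-v_j\|^2$ if $X$ is the Gram matrix of vectors $(v_i)_{i\in V}$), put $$A_{ij}=L_{ij}-L_{i0}+L_{j0},\qquad K=\sum_{\{i,j\}\in\binom V2}\omega_i\omega_jL_{ij},\qquad T_p=L_{ij}+L_{jk}-L_{ik}\ \text{ for } p=(\{i,k\},j)\in\mathcal T,$$ where $\mathcal T$ is the set of all pairs $(\{i,k\},j)$ with $i,j,k\in V$ distinct. **SDP.** Minimize $\frac12\sum_{e\in E}w_ed_e$ over all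 $X\succeq0$ and $d\in\mathbb R^E$ subject to $d_e\ge A_{ij}\bullet X$ for all $e\in E$ and $(i,j)\in\mathsf T_e\times\mathsf H_e$; $T_p\bullet X\ge0$ for all $p\in\mathcal T$; $K\bullet X=1$; and $d_e\ge0$ for all $e\in E$. The optimal value is the infimum ($+\infty$ if there is no feasible solution, which happens only if $n=1$). A matrix $X\succeq0$ with $K\bullet X=1$ and $T_p\bullet X\ge0$ for all $p\in\mathcal T$ is called primal feasible. **Oracle.** Let $\alpha>0$ and $\rho>0$. An oracle for $\alpha$ has width $\rho$ if, given any $X\succeq0$ with $K\bullet X=1$, it outputs either (i) a set $\emptyset\ne S\subsetneq V$ with $$\frac{w(\partial^+(S))}{\omega(S)\,\omega(V\setminus S)}\le C\sqrt{\log(\kappa n)}\cdot\alpha,$$ where $\partial^+(S)=\{e\in E:\mathsf T_e\cap S\ne\emptyset,\ \mathsf H_e\setminus S\neq\emptyset\}$ and $C$ is a fixed constant, or (ii) a number $z\ge\alpha$, numbers $f_p\ge0$ $(p\in\mathcal T)$ and a symmetric matrix $F\in\mathbb R^{V\times V}$ such that - $\big(\sum_pf_pT_p+zK\big)\bullet X\le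 F\bullet X$; - $F\bullet X^*\le\frac12\sum_{e\in E}w_ed^*_e$ for every primal feasible $X^*$, where $d^*_e=\max\{0,\max_{(i,j)\in\mathsf T_e\times\mathsf H_e}A_{ij}\bullet X^*\}$; - $Fx=0$ for all $x\in\mathrm{span}\{\mathbf 1\}$; - the spectral norm of $\sum_pf_pT_p+zK-F$ is at most $\rho$. The oracle may be deterministic, randomized or stateful. **Algorithm.** Let $$T=\left\lceil\frac{16\,\kappa^2\rho^2n^2\ln n}{\alpha^2W^4}\right\rceil,\qquad \eta=\sqrt{\frac{\ln n}{T}},\qquad W^{(1)}=I.$$ In iteration $t=1,\dots,T$, run the oracle on $X^{(t)}=W^{(t)}/(K\bullet W^{(t)})$. If it returns a subset $S$, stop and return $S$. Otherwise it returns $(z^{(t)},(f^{(t)}_p)_p,F^{(t)})$ as in (ii); put $$M^{(t)}=-\tfrac1\rho\Big(\sum_pf^{(t)}_pT_p+z^{(t)}K-F^{(t)}\Big),\qquad W^{(t+1)}=\exp\Big(-\eta\sum_{\tau=1}^tM^{(\tau)}\Big).$$ **Lemma (Correctness).** If the oracle has width $\rho$ and does not return a subset in any of the $T$ iterations of the algorithm,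 then the optimal value of the SDP is at least $\alpha/2$. -/

import Mathlib

open Matrix

noncomputable section

namespace DirSparsestCut

/-- An edge-weighted directed hypergraph with vertex set `V` and hyperedges indexed by `E`;
the hyperedge `e` points from its tail set to its head set, both nonempty
(and not necessarily disjoint), and has weight `w e ≥ 0`. -/
structure DirectedHypergraph (V E : Type*) where
  tail : E → Finset V
  head : E → Finset V
  tail_nonempty : ∀ e, (tail e).Nonempty
  head_nonempty : ∀ e, (head e).Nonempty
  w : E → ℝ
  w_nonneg : ∀ e, 0 ≤ w e

/-- The vertex weights `ω` are `κ`-skewed. -/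
def IsSkewed {V : Type*} (κ : ℝ) (ω : V → ℝ) : Prop :=
  ∀ i, 1 ≤ ω i ∧ ω i ≤ κ

/-- Triples `({i, k}, j)` with `i, j, k` distinct; they index the `ℓ₂²`-triangle inequalities
`‖v i - v k‖² ≤ ‖v i - v j‖² + ‖v j - v k‖²`. -/
abbrev Triple (V : Type*) : Type _ :=
  {p : Sym2 V × V // ¬ p.1.IsDiag ∧ p.2 ∉ p.1}

section Matrices

variable {V : Type*} [Fintype V] [DecidableEq V]

/-- `A • B = Tr(Aᵀ B)`. -/
def bullet (A B : Matrix V V ℝ) : ℝ := (Aᵀ * B).trace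

/-- The spectral norm (the operator norm for the Euclidean norm). -/
def spectralNorm (A : Matrix V V ℝ) : ℝ := ‖Matrix.toEuclideanCLM (𝕜 := ℝ) A‖

/-- The symmetric matrix `(e_i - e_j)(e_i - e_j)ᵀ`, which represents `‖v i - v j‖²`
(see `bullet_sqDistMatrix`). -/
def sqDistMatrix (i j : V) : Matrix V V ℝ :=
  Matrix.vecMulVec (Pi.single i 1 - Pi.single j 1) (Pi.single i 1 - Pi.single j 1)

theorem sqDistMatrix_comm (i j : V) : sqDistMatrix i j = sqDistMatrix j i := by
  ext a b
  simp only [sqDistMatrix, Matrix.vecMulVec_apply, Pi.sub_apply]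
  ring

/-- If `X` is the Gram matrix of the vectors `v`, then `sqDistMatrix i j • X = ‖v i - v j‖²`. -/
theorem bullet_sqDistMatrix {F : Type*} [NormedAddCommGroup F] [InnerProductSpace ℝ F]
    (v : V → F) (i j : V) :
    bullet (sqDistMatrix i j) (Matrix.of fun a b => inner ℝ (v a) (v b)) =
      ‖v i - v j‖ ^ 2 := by
  have h : ∀ X : Matrix V V ℝ,
      bullet (sqDistMatrix i j) X = X i i - X i j - X j i + X j j := by
    intro X
    rw [bullet, sqDistMatrix, Matrix.transpose_vecMulVec, Matrix.vecMulVec_mul,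
      Matrix.trace_vecMulVec, dotProduct_comm, ← Matrix.dotProduct_mulVec]
    simp [Matrix.mulVec_sub, sub_dotProduct]
    ring
  rw [h, norm_sub_sq_real]
  simp only [Matrix.of_apply, real_inner_self_eq_norm_sq, real_inner_comm (v i) (v j)]
  ring

/-- `A_ij`, representing the directed distance
`d(i, j) = ‖v i - v j‖² - ‖v i - v o‖² + ‖v j - v o‖²` with respect to the root `o`. -/
def dirDistMatrix (o i j : V) : Matrix V V ℝ :=
  sqDistMatrix i j - sqDistMatrix i o + sqDistMatrix j o

/-- `T_p` for `p = ({i, k}, j)`, representing `‖v i - v j‖² + ‖v j - v k‖² - ‖v i - v k‖²`. -/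
def triMatrix (p : Triple V) : Matrix V V ℝ :=
  Sym2.lift
    ⟨fun i k => sqDistMatrix i p.1.2 + sqDistMatrix p.1.2 k - sqDistMatrix i k, fun i k => by
      dsimp only
      rw [sqDistMatrix_comm i k, sqDistMatrix_comm i p.1.2, sqDistMatrix_comm p.1.2 k, add_comm]⟩
    p.1.1

/-- `K`, representing the sum of `ω i * ω j * ‖v i - v j‖²` over unordered pairs `{i, j}`
(half of the sum over ordered pairs; the terms with `i = j` vanish). -/
def demandMatrix (ω : V → ℝ) : Matrix V V ℝ :=
  (1 / 2 : ℝ) • ∑ i, ∑ j, (ω i * ω j) • sqDistMatrix i j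

/-- A dual solution `(z, (f_p)_p)` together with a matrix `F`. -/
structure DualSolution (V : Type*) where
  z : ℝ
  f : Triple V → ℝ
  F : Matrix V V ℝ

/-- `∑_p f_p T_p + z K - F`. -/
def DualSolution.slack (ω : V → ℝ) (D : DualSolution V) : Matrix V V ℝ :=
  (∑ p, D.f p • triMatrix p) + D.z • demandMatrix ω - D.F

/-- What the oracle may answer: a subset of the vertices, or a dual solution. -/
inductive OracleOutput (V : Type*) where
  | subset (S : Finset V) : OracleOutput V
  | dual (D : DualSolution V) : OracleOutput V

/-- An oracle assigns to each candidate matrix the set of its possible answers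
(one answer for a deterministic oracle, several for a randomized or a stateful one). -/
abbrev Oracle (V : Type*) : Type _ := Matrix V V ℝ → Set (OracleOutput V)

/-- The constraints of the SDP on the matrix variable `X`. -/
structure PrimalFeasible (ω : V → ℝ) (X : Matrix V V ℝ) : Prop where
  posSemidef : X.PosSemidef
  triangle : ∀ p : Triple V, 0 ≤ bullet (triMatrix p) X
  sum_one : bullet (demandMatrix ω) X = 1

end Matrices

namespace DirectedHypergraph

variable {V E : Type*} [Fintype V] [DecidableEq V] [Fintype E]

/-- Feasible solutions `(X, d)` of the SDP. -/
structure SDPFeasible (H : DirectedHypergraph V E) (ω : V → ℝ) (o : V)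
    (X : Matrix V V ℝ) (d : E → ℝ) : Prop where
  primal : PrimalFeasible ω X
  dist_le : ∀ e, ∀ i ∈ H.tail e, ∀ j ∈ H.head e, 0 ≤ d e - bullet (dirDistMatrix o i j) X
  nonneg : ∀ e, 0 ≤ d e

/-- The objective function of the SDP. -/
def objective (H : DirectedHypergraph V E) (d : E → ℝ) : ℝ :=
  (1 / 2 : ℝ) * ∑ e, H.w e * d e

/-- The optimal value of the SDP: the infimum of the objective over all feasible solutions
(`⊤` if there is none, which happens only when `V` has a single vertex). -/
def sdpValue (H : DirectedHypergraph V E) (ω : V → ℝ) (o : V) : EReal :=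
  ⨅ (X : Matrix V V ℝ) (d : E → ℝ) (_ : H.SDPFeasible ω o X d), (H.objective d : EReal)

/-- `d_e = max {0, max_{(i,j) ∈ tail e × head e} A_ij • X}`. -/
def inducedDist (H : DirectedHypergraph V E) (o : V) (X : Matrix V V ℝ) (e : E) : ℝ :=
  max 0 ((H.tail e ×ˢ H.head e).sup' ((H.tail_nonempty e).product (H.head_nonempty e))
    fun q => bullet (dirDistMatrix o q.1 q.2) X)

/-- The weight of the out-going cut of `S`: the hyperedges whose tail meets `S` and whose head
meets the complement of `S`. -/
def outCutWeight (H : DirectedHypergraph V E) (S : Finset V) : ℝ :=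
  ∑ e with (H.tail e ∩ S).Nonempty ∧ (H.head e ∩ Sᶜ).Nonempty, H.w e

/-- The directed sparsity of `S` with product demands. -/
def sparsity (H : DirectedHypergraph V E) (ω : V → ℝ) (S : Finset V) : ℝ :=
  H.outCutWeight S / ((∑ i ∈ S, ω i) * ∑ i ∈ Sᶜ, ω i)

/-- The conditions on a dual solution that an oracle of width `ρ` may return on input `X`. -/
structure GoodDual (H : DirectedHypergraph V E) (ω : V → ℝ) (o : V) (α ρ : ℝ)
    (X : Matrix V V ℝ) (D : DualSolution V) : Prop where
  f_nonneg : ∀ p, 0 ≤ D.f p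
  F_symm : D.F.IsSymm
  z_ge : α ≤ D.z
  bullet_le : bullet ((∑ p, D.f p • triMatrix p) + D.z • demandMatrix ω) X ≤ bullet D.F X
  F_le : ∀ X' : Matrix V V ℝ, PrimalFeasible ω X' →
    bullet D.F X' ≤ H.objective (H.inducedDist o X')
  F_ones : ∀ x ∈ Submodule.span ℝ {(1 : V → ℝ)}, D.F *ᵥ x = 0
  norm_le : spectralNorm (D.slack ω) ≤ ρ

/-- The subsets that the oracle may return; `C` is the constant in `O(√(log κn))`. -/
structure GoodSubset (H : DirectedHypergraph V E) (ω : V → ℝ) (κ C α : ℝ) (S : Finset V) :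
    Prop where
  nonempty : S.Nonempty
  ne_univ : S ≠ Finset.univ
  sparsity_le : H.sparsity ω S ≤ C * √(Real.log (κ * Fintype.card V)) * α

/-- `O` is an oracle for the candidate value `α` that has width `ρ`: on each input `X ⪰ 0` with
`K • X = 1` it answers, and each answer is a sparse subset or a good dual solution. -/
def HasWidth (H : DirectedHypergraph V E) (ω : V → ℝ) (o : V) (κ C α ρ : ℝ) (O : Oracle V) :
    Prop :=
  ∀ X : Matrix V V ℝ, X.PosSemidef → bullet (demandMatrix ω) X = 1 →
    (O X).Nonempty ∧
    (∀ S, OracleOutput.subset S ∈ O X → H.GoodSubset ω κ C α S) ∧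
    (∀ D, OracleOutput.dual D ∈ O X → H.GoodDual ω o α ρ X D)

end DirectedHypergraph

section Algorithm

variable {V : Type*} [Fintype V] [DecidableEq V]

/-- The number of iterations, `⌈16 κ² ρ² n² ln n / (α² ω(V)⁴)⌉`. -/
def numIter (ω : V → ℝ) (κ α ρ : ℝ) : ℕ :=
  ⌈16 * κ ^ 2 * ρ ^ 2 * (Fintype.card V : ℝ) ^ 2 * Real.log (Fintype.card V) /
    (α ^ 2 * (∑ i, ω i) ^ 4)⌉₊

/-- The step size `η = √(ln n / T)`. -/
def stepSize (V : Type*) [Fintype V] (T : ℕ) : ℝ :=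
  √(Real.log (Fintype.card V) / T)

/-- `M = -(1/ρ) (∑_p f_p T_p + z K - F)`. -/
def lossMatrix (ω : V → ℝ) (ρ : ℝ) (D : DualSolution V) : Matrix V V ℝ :=
  (-(1 / ρ)) • D.slack ω

/-- The weight matrix computed from the first `t` dual solutions `D 0, …, D (t - 1)`:
`exp (-η ∑_{s < t} M_s)`, which is the identity matrix for `t = 0`. -/
def weightMatrix (ω : V → ℝ) (ρ η : ℝ) (D : ℕ → DualSolution V) (t : ℕ) : Matrix V V ℝ :=
  NormedSpace.exp (-(η • ∑ s ∈ Finset.range t, lossMatrix ω ρ (D s)))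

/-- The primal candidate `W / (K • W)` computed from the first `t` dual solutions. -/
def primalCandidate (ω : V → ℝ) (ρ η : ℝ) (D : ℕ → DualSolution V) (t : ℕ) : Matrix V V ℝ :=
  (bullet (demandMatrix ω) (weightMatrix ω ρ η D t))⁻¹ • weightMatrix ω ρ η D t

/-- `D 0, …, D (T - 1)` are the answers of the oracle `O` in a run of `T` iterations of the
primal-dual algorithm in which the oracle never returns a subset. -/
def IsSubsetFreeRun (ω : V → ℝ) (ρ : ℝ) (O : Oracle V) (T : ℕ) (D : ℕ → DualSolution V) :
    Prop :=
  ∀ t < T, OracleOutput.dual (D t) ∈ O (primalCandidate ω ρ (stepSize V T) D t)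

end Algorithm

end DirSparsestCut

end

/-! The proof is a matrix multiplicative weights argument. Let `N t = (η / ρ) • slack (D t)`, so
that the weight matrix is `W t = exp (N 0 + ⋯ + N (t - 1))`. The oracle makes the trace of
`N t * W t` nonpositive, hence the potential `tr (W t)` grows by at most the factor
`exp (‖N t‖ ^ 2)` in each step. For this bound no Golden–Thompson inequality is needed:
in eigenbases of two Hermitian matrices, traces of products of their functions become double sums
with nonnegative weights, so that it suffices to compare `exp` at two real numbers.

After `T` steps `tr (W T) ≤ n exp (T η ^ 2)`, so every eigenvalue of `∑ t < T, N t` is at most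
`log n + T η ^ 2`. This sum annihilates the all-ones vector, and on such forms the identity matrix
can be replaced by `K / ∑ i, ω i`, where `K` is the demand matrix. Pairing with a feasible `X`
bounds `∑ t < T, N t • X`, whereas each `slack (D t) • X` is at least `α` minus the objective.
The choice of `T` and `η` turns this into an objective value of at least `α / 2`.
-/

noncomputable section

namespace DirSparsestCut

section Scalar

theorem exp_le_one_add_add_sq_mul (x : ℝ) :
    Real.exp x ≤ 1 + x + x ^ 2 * (Real.exp x / 4 + 1 / 2) := by
  rcases le_or_gt 0 x with hx | hx
  · have hlog : 2 * (Real.exp x - 1) ≤ x * (Real.exp x + 1) := by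
      have h := Real.le_log_one_add_of_nonneg (sub_nonneg.2 (Real.one_le_exp hx))
      rw [add_sub_cancel, Real.log_exp, div_le_iff₀ (by linarith [Real.exp_pos x])] at h
      linarith
    nlinarith [mul_le_mul_of_nonneg_left hlog (by linarith : 0 ≤ 2 + x), sq_nonneg x]
  · have hquad : (1 - x + x ^ 2 / 2) * Real.exp x ≤ 1 := by
      have h := Real.quadratic_le_exp_of_nonneg (neg_nonneg.2 hx.le)
      calc (1 - x + x ^ 2 / 2) * Real.exp x ≤ Real.exp (-x) * Real.exp x := by
            gcongr
            linarith
        _ = 1 := by rw [← Real.exp_add, neg_add_cancel, Real.exp_zero]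
    have htaylor : Real.exp x ≤ 1 + x + x ^ 2 / 2 := by
      refine le_of_mul_le_mul_left ?_ (by nlinarith : 0 < 1 - x + x ^ 2 / 2)
      nlinarith [sq_nonneg (x ^ 2)]
    nlinarith [mul_nonneg (sq_nonneg x) (Real.exp_pos x).le]

theorem exp_sub_exp_sub_le (a b : ℝ) :
    Real.exp a - Real.exp b - (a - b) * Real.exp b ≤
      (a - b) ^ 2 * (Real.exp a / 4 + Real.exp b / 2) := by
  have h := mul_le_mul_of_nonneg_right (exp_le_one_add_add_sq_mul (a - b)) (Real.exp_pos b).le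
  have e : Real.exp (a - b) * Real.exp b = Real.exp a := by rw [← Real.exp_add, sub_add_cancel]
  linear_combination h + ((a - b) ^ 2 / 4 - 1) * e

theorem mul_exp_le_exp_sub_exp (a b : ℝ) : (a - b) * Real.exp b ≤ Real.exp a - Real.exp b := by
  have h := mul_le_mul_of_nonneg_right (Real.add_one_le_exp (a - b)) (Real.exp_pos b).le
  rw [← Real.exp_add, sub_add_cancel] at h
  linarith

end Scalar

section SpectralTrace

variable {n 𝕜 : Type*} [RCLike 𝕜] [Fintype n] [DecidableEq n] {A B : Matrix n n 𝕜}

/-- The squared moduli `|⟨uᵢ, vⱼ⟩|²` of the inner products of the eigenvectors `uᵢ` of `A` with the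
eigenvectors `vⱼ` of `B`. They turn traces of products of functions of `A` and of `B` into double
sums over the eigenvalues, which reduces trace inequalities to scalar ones. -/
def eigenOverlap (hA : A.IsHermitian) (hB : B.IsHermitian) (i j : n) : ℝ :=
  ‖(star (hA.eigenvectorUnitary : Matrix n n 𝕜) * hB.eigenvectorUnitary) i j‖ ^ 2

theorem eigenOverlap_nonneg (hA : A.IsHermitian) (hB : B.IsHermitian) (i j : n) :
    0 ≤ eigenOverlap hA hB i j :=
  sq_nonneg _

theorem re_trace_cfc_mul_mul_cfc_mul_conjTranspose (hA : A.IsHermitian) (hB : B.IsHermitian)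
    (f g : ℝ → ℝ) (M : Matrix n n 𝕜) :
    RCLike.re (cfc f A * M * cfc g B * Mᴴ).trace =
      ∑ i, ∑ j, f (hA.eigenvalues i) * g (hB.eigenvalues j) *
        ‖(star (hA.eigenvectorUnitary : Matrix n n 𝕜) * M * hB.eigenvectorUnitary) i j‖ ^ 2 := by
  set P := star (hA.eigenvectorUnitary : Matrix n n 𝕜) * M * hB.eigenvectorUnitary with hP
  have hconj : (cfc f A * M * cfc g B * Mᴴ).trace =
      (diagonal (RCLike.ofReal ∘ f ∘ hA.eigenvalues) * P *
        diagonal (RCLike.ofReal ∘ g ∘ hB.eigenvalues) * Pᴴ).trace := by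
    rw [hA.cfc_eq, hB.cfc_eq, IsHermitian.cfc, IsHermitian.cfc, Unitary.conjStarAlgAut_apply,
      Unitary.conjStarAlgAut_apply]
    simp only [hP, star_eq_conjTranspose, conjTranspose_mul, conjTranspose_conjTranspose,
      Matrix.mul_assoc]
    rw [Matrix.trace_mul_comm]
    simp only [Matrix.mul_assoc]
  rw [hconj]
  simp only [trace, diag_apply, Matrix.mul_apply (N := Pᴴ), diagonal_mul, mul_diagonal,
    conjTranspose_apply, map_sum, Function.comp_apply]
  refine Finset.sum_congr rfl fun i _ => Finset.sum_congr rfl fun j _ => ?_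
  rw [mul_right_comm _ (P i j), mul_assoc _ (P i j), RCLike.star_def, RCLike.mul_conj]
  norm_cast

theorem star_eigenvectorUnitary_mul_sub_mul_apply (hA : A.IsHermitian) (hB : B.IsHermitian)
    (i j : n) :
    (star (hA.eigenvectorUnitary : Matrix n n 𝕜) * (A - B) * hB.eigenvectorUnitary) i j =
      ((hA.eigenvalues i - hB.eigenvalues j : ℝ) : 𝕜) *
        (star (hA.eigenvectorUnitary : Matrix n n 𝕜) * hB.eigenvectorUnitary) i j := by
  set U := (hA.eigenvectorUnitary : Matrix n n 𝕜)
  set V := (hB.eigenvectorUnitary : Matrix n n 𝕜)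
  have hUA : star U * A = diagonal (RCLike.ofReal ∘ hA.eigenvalues) * star U := by
    conv_lhs => rw [hA.spectral_theorem, Unitary.conjStarAlgAut_apply]
    rw [← Matrix.mul_assoc, ← Matrix.mul_assoc, Unitary.coe_star_mul_self, Matrix.one_mul]
  have hBV : B * V = V * diagonal (RCLike.ofReal ∘ hB.eigenvalues) := by
    conv_lhs => rw [hB.spectral_theorem, Unitary.conjStarAlgAut_apply]
    rw [Matrix.mul_assoc, Unitary.coe_star_mul_self, Matrix.mul_one]
  rw [Matrix.mul_sub, Matrix.sub_mul, hUA, Matrix.mul_assoc _ B, hBV, ← Matrix.mul_assoc,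
    Matrix.mul_assoc (diagonal _), Matrix.sub_apply, diagonal_mul, mul_diagonal, RCLike.ofReal_sub]
  simp only [Function.comp_apply]
  ring

theorem re_trace_cfc_mul_sub_mul_cfc_mul_sub (hA : A.IsHermitian) (hB : B.IsHermitian)
    (f g : ℝ → ℝ) :
    RCLike.re (cfc f A * (A - B) * cfc g B * (A - B)).trace =
      ∑ i, ∑ j, f (hA.eigenvalues i) * g (hB.eigenvalues j) *
        (hA.eigenvalues i - hB.eigenvalues j) ^ 2 * eigenOverlap hA hB i j := by
  have h := re_trace_cfc_mul_mul_cfc_mul_conjTranspose hA hB f g (A - B)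
  simpa only [(hA.sub hB).eq, star_eigenvectorUnitary_mul_sub_mul_apply, norm_mul, mul_pow,
    RCLike.norm_ofReal, sq_abs, ← mul_assoc] using! h

theorem re_trace_cfc_mul_cfc (hA : A.IsHermitian) (hB : B.IsHermitian) (f g : ℝ → ℝ) :
    RCLike.re (cfc f A * cfc g B).trace =
      ∑ i, ∑ j, f (hA.eigenvalues i) * g (hB.eigenvalues j) * eigenOverlap hA hB i j := by
  simpa only [conjTranspose_one, Matrix.mul_one] using!
    re_trace_cfc_mul_mul_cfc_mul_conjTranspose hA hB f g 1

theorem re_trace_cfc_sub_sub (hA : A.IsHermitian) (hB : B.IsHermitian) (f g : ℝ → ℝ) :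
    RCLike.re (cfc f A).trace - RCLike.re (cfc f B).trace - RCLike.re ((A - B) * cfc g B).trace =
      ∑ i, ∑ j, (f (hA.eigenvalues i) - f (hB.eigenvalues j) -
        (hA.eigenvalues i - hB.eigenvalues j) * g (hB.eigenvalues j)) * eigenOverlap hA hB i j := by
  have hBg : cfc (fun x => x * g x) B = B * cfc g B := by
    rw [cfc_mul (fun x => x) g B continuousOn_id (B.finite_real_spectrum.continuousOn g),
      cfc_id' ℝ B]
  have h₁ := re_trace_cfc_mul_cfc hA hB f (fun _ => 1)
  have h₂ := re_trace_cfc_mul_cfc hA hB (fun _ => 1) f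
  have h₃ := re_trace_cfc_mul_cfc hA hB (fun x => x) g
  have h₄ := re_trace_cfc_mul_cfc hA hB (fun _ => 1) (fun x => x * g x)
  rw [cfc_const_one ℝ B, Matrix.mul_one] at h₁
  rw [cfc_const_one ℝ A, Matrix.one_mul] at h₂ h₄
  rw [cfc_id' ℝ A] at h₃
  rw [hBg] at h₄
  rw [Matrix.sub_mul, trace_sub, map_sub, h₁, h₂, h₃, h₄]
  simp only [← Finset.sum_sub_distrib]
  exact Finset.sum_congr rfl fun i _ => Finset.sum_congr rfl fun j _ => by ring

end SpectralTrace

section TraceExp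

open scoped MatrixOrder Matrix.Norms.L2Operator ComplexOrder

variable {n 𝕜 : Type*} [RCLike 𝕜] [Fintype n] {A B X N : Matrix n n 𝕜}

theorem re_trace_mul_nonneg (hA : 0 ≤ A) (hX : 0 ≤ X) : 0 ≤ RCLike.re (A * X).trace := by
  classical
  obtain ⟨Y, rfl⟩ := CStarAlgebra.nonneg_iff_eq_star_mul_self.1 hX
  have h : (Y * A * Yᴴ).PosSemidef := (nonneg_iff_posSemidef.1 hA).mul_mul_conjTranspose_same Y
  rw [← Matrix.mul_assoc, Matrix.trace_mul_comm, ← Matrix.mul_assoc, star_eq_conjTranspose]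
  exact (RCLike.nonneg_iff.1 h.trace_nonneg).1

theorem re_trace_mul_le_of_le (hAB : A ≤ B) (hX : 0 ≤ X) :
    RCLike.re (A * X).trace ≤ RCLike.re (B * X).trace := by
  have h := re_trace_mul_nonneg (sub_nonneg.2 hAB) hX
  rwa [Matrix.sub_mul, trace_sub, map_sub, sub_nonneg] at h

variable [DecidableEq n]

theorem re_trace_smul_one_mul (c : ℝ) (X : Matrix n n 𝕜) :
    RCLike.re ((c • (1 : Matrix n n 𝕜)) * X).trace = c * RCLike.re X.trace := by
  rw [smul_mul_assoc, Matrix.one_mul, trace_smul, RCLike.smul_re]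

theorem cfc_exp_eq_exp (hA : A.IsHermitian) : cfc Real.exp A = NormedSpace.exp A := by
  let _ : NormedAlgebra ℝ (Matrix n n 𝕜) :=
    { (inferInstance : Algebra ℝ (Matrix n n 𝕜)) with
      norm_smul_le := fun c M => by
        rw [RCLike.real_smul_eq_coe_smul (K := 𝕜) c M, norm_smul, RCLike.norm_ofReal,
          Real.norm_eq_abs] }
  exact CFC.real_exp_eq_normedSpace_exp hA

theorem exp_nonneg (hA : A.IsHermitian) : 0 ≤ NormedSpace.exp A := by
  rw [← cfc_exp_eq_exp hA]
  exact cfc_nonneg fun x _ => (Real.exp_pos x).le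

theorem posDef_exp (hA : A.IsHermitian) : (NormedSpace.exp A).PosDef :=
  (nonneg_iff_posSemidef.1 (exp_nonneg hA)).posDef_iff_isUnit.2 (Matrix.isUnit_exp A)

theorem re_trace_exp_nonneg (hA : A.IsHermitian) : 0 ≤ RCLike.re (NormedSpace.exp A).trace :=
  (RCLike.nonneg_iff.1 (posDef_exp hA).posSemidef.trace_nonneg).1

theorem re_trace_exp_mono (hA : A.IsHermitian) (hB : B.IsHermitian) (hAB : A ≤ B) :
    RCLike.re (NormedSpace.exp A).trace ≤ RCLike.re (NormedSpace.exp B).trace := by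
  have hklein : 0 ≤ RCLike.re (NormedSpace.exp B).trace - RCLike.re (NormedSpace.exp A).trace -
      RCLike.re ((B - A) * NormedSpace.exp A).trace := by
    rw [← cfc_exp_eq_exp hA, ← cfc_exp_eq_exp hB, re_trace_cfc_sub_sub hB hA]
    refine Finset.sum_nonneg fun i _ => Finset.sum_nonneg fun j _ =>
      mul_nonneg (sub_nonneg.2 (mul_exp_le_exp_sub_exp _ _)) (eigenOverlap_nonneg hB hA i j)
  linarith [re_trace_mul_nonneg (sub_nonneg.2 hAB) (exp_nonneg hA)]

theorem re_trace_exp_sub_sub_le (hA : A.IsHermitian) (hB : B.IsHermitian) :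
    RCLike.re (NormedSpace.exp A).trace - RCLike.re (NormedSpace.exp B).trace -
        RCLike.re ((A - B) * NormedSpace.exp B).trace ≤
      RCLike.re ((A - B) * (A - B) * NormedSpace.exp A).trace / 4 +
        RCLike.re ((A - B) * (A - B) * NormedSpace.exp B).trace / 2 := by
  have hexpA : RCLike.re ((A - B) * (A - B) * NormedSpace.exp A).trace =
      ∑ i, ∑ j, Real.exp (hA.eigenvalues i) * (hA.eigenvalues i - hB.eigenvalues j) ^ 2 *
        eigenOverlap hA hB i j := by
    rw [Matrix.trace_mul_comm, ← Matrix.mul_assoc, ← cfc_exp_eq_exp hA]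
    simpa only [cfc_const_one ℝ B, Matrix.mul_one, mul_one] using
      re_trace_cfc_mul_sub_mul_cfc_mul_sub hA hB Real.exp fun _ => 1
  have hexpB : RCLike.re ((A - B) * (A - B) * NormedSpace.exp B).trace =
      ∑ i, ∑ j, Real.exp (hB.eigenvalues j) * (hA.eigenvalues i - hB.eigenvalues j) ^ 2 *
        eigenOverlap hA hB i j := by
    rw [Matrix.mul_assoc, Matrix.trace_mul_comm, ← cfc_exp_eq_exp hB]
    simpa only [cfc_const_one ℝ A, Matrix.one_mul, one_mul] using
      re_trace_cfc_mul_sub_mul_cfc_mul_sub hA hB (fun _ => 1) Real.exp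
  rw [hexpA, hexpB, ← cfc_exp_eq_exp hA, ← cfc_exp_eq_exp hB, re_trace_cfc_sub_sub hA hB]
  simp only [Finset.sum_div, ← Finset.sum_add_distrib]
  refine Finset.sum_le_sum fun i _ => Finset.sum_le_sum fun j _ => ?_
  have h := mul_le_mul_of_nonneg_right
    (exp_sub_exp_sub_le (hA.eigenvalues i) (hB.eigenvalues j)) (eigenOverlap_nonneg hA hB i j)
  linarith

theorem abs_le_norm_of_mem_spectrum {x : ℝ} (hx : x ∈ spectrum ℝ A) : |x| ≤ ‖A‖ := by
  have : Nonempty n := not_isEmpty_iff.1 fun _ => by simp [spectrum.of_subsingleton] at hx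
  have h := spectrum.norm_le_norm_of_mem ((spectrum.algebraMap_mem_iff 𝕜).2 hx)
  simpa using h

theorem le_norm_smul_one (hA : A.IsHermitian) : A ≤ ‖A‖ • (1 : Matrix n n 𝕜) := by
  rw [← Algebra.algebraMap_eq_smul_one]
  exact le_algebraMap_of_spectrum_le
    fun x hx => (le_abs_self x).trans (abs_le_norm_of_mem_spectrum hx)

theorem mul_self_le_norm_sq_smul_one (hA : A.IsHermitian) :
    A * A ≤ ‖A‖ ^ 2 • (1 : Matrix n n 𝕜) := by
  have hsq : cfc (fun x : ℝ => x * x) A = A * A := by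
    rw [cfc_mul (fun x => x) (fun x => x) A, cfc_id' ℝ A]
  rw [← Algebra.algebraMap_eq_smul_one, ← hsq]
  refine cfc_le_algebraMap _ _ _ fun x hx => ?_
  rw [← sq, ← sq_abs]
  exact pow_le_pow_left₀ (abs_nonneg x) (abs_le_norm_of_mem_spectrum hx) 2

theorem exp_add_smul_one (A : Matrix n n 𝕜) (c : ℝ) :
    NormedSpace.exp (A + c • (1 : Matrix n n 𝕜)) = Real.exp c • NormedSpace.exp A := by
  have hc : NormedSpace.exp (c • (1 : Matrix n n 𝕜)) = Real.exp c • 1 := by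
    rw [← cfc_exp_eq_exp (isHermitian_one.smul (.all c)), ← Algebra.algebraMap_eq_smul_one,
      cfc_algebraMap, Algebra.algebraMap_eq_smul_one]
  rw [Matrix.exp_add_of_commute _ _ ((Commute.one_right A).smul_right c), hc, mul_smul_comm,
    Matrix.mul_one]

theorem re_trace_exp_add_smul_one (A : Matrix n n 𝕜) (c : ℝ) :
    RCLike.re (NormedSpace.exp (A + c • (1 : Matrix n n 𝕜))).trace =
      Real.exp c * RCLike.re (NormedSpace.exp A).trace := by
  rw [exp_add_smul_one, trace_smul, RCLike.smul_re]

theorem re_trace_mul_self_mul_le (hN : N.IsHermitian) (hX : 0 ≤ X) :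
    RCLike.re (N * N * X).trace ≤ ‖N‖ ^ 2 * RCLike.re X.trace :=
  (re_trace_mul_le_of_le (mul_self_le_norm_sq_smul_one hN) hX).trans_eq
    (re_trace_smul_one_mul _ _)

theorem re_trace_exp_add_le_of_norm_le_one (hA : A.IsHermitian) (hN : N.IsHermitian)
    (hNA : RCLike.re (N * NormedSpace.exp A).trace ≤ 0) (hN1 : ‖N‖ ≤ 1) :
    RCLike.re (NormedSpace.exp (A + N)).trace ≤
      Real.exp (‖N‖ ^ 2) * RCLike.re (NormedSpace.exp A).trace := by
  set p := RCLike.re (NormedSpace.exp A).trace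
  set q := RCLike.re (NormedSpace.exp (A + N)).trace
  have hp : 0 ≤ p := re_trace_exp_nonneg hA
  have hc : ‖N‖ ^ 2 ≤ 1 := pow_le_one₀ (norm_nonneg N) hN1
  have hquad : (1 - ‖N‖ ^ 2 / 4) * q ≤ (1 + ‖N‖ ^ 2 / 2) * p := by
    have h := re_trace_exp_sub_sub_le (hA.add hN) hA
    rw [add_sub_cancel_left] at h
    linarith [re_trace_mul_self_mul_le hN (exp_nonneg (hA.add hN)),
      re_trace_mul_self_mul_le hN (exp_nonneg hA)]
  calc q ≤ (1 + ‖N‖ ^ 2) * p := by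
        refine le_of_mul_le_mul_left (hquad.trans ?_) (by linarith : 0 < 1 - ‖N‖ ^ 2 / 4)
        rw [← mul_assoc]
        gcongr
        nlinarith [sq_nonneg ‖N‖]
    _ ≤ Real.exp (‖N‖ ^ 2) * p := by
        gcongr
        linarith [Real.add_one_le_exp (‖N‖ ^ 2)]

theorem re_trace_exp_add_le (hA : A.IsHermitian) (hN : N.IsHermitian)
    (hNA : RCLike.re (N * NormedSpace.exp A).trace ≤ 0) :
    RCLike.re (NormedSpace.exp (A + N)).trace ≤
      Real.exp (‖N‖ ^ 2) * RCLike.re (NormedSpace.exp A).trace := by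
  rcases le_total ‖N‖ 1 with hN1 | hN1
  · exact re_trace_exp_add_le_of_norm_le_one hA hN hNA hN1
  · have hp : 0 ≤ RCLike.re (NormedSpace.exp A).trace := re_trace_exp_nonneg hA
    calc RCLike.re (NormedSpace.exp (A + N)).trace
        ≤ RCLike.re (NormedSpace.exp (A + ‖N‖ • (1 : Matrix n n 𝕜))).trace :=
          re_trace_exp_mono (hA.add hN) (hA.add (isHermitian_one.smul (.all ‖N‖)))
            (add_le_add_right (le_norm_smul_one hN) A)
      _ = Real.exp ‖N‖ * RCLike.re (NormedSpace.exp A).trace := re_trace_exp_add_smul_one A ‖N‖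
      _ ≤ Real.exp (‖N‖ ^ 2) * RCLike.re (NormedSpace.exp A).trace := by
          gcongr
          exact le_self_pow₀ hN1 two_ne_zero

end TraceExp

section MultiplicativeWeights

open scoped MatrixOrder Matrix.Norms.L2Operator

variable {n 𝕜 : Type*} [RCLike 𝕜] [Fintype n] [DecidableEq n]

theorem le_smul_one_of_re_trace_exp_le {A : Matrix n n 𝕜} (hA : A.IsHermitian) {c : ℝ}
    (h : RCLike.re (NormedSpace.exp A).trace ≤ Real.exp c) : A ≤ c • (1 : Matrix n n 𝕜) := by
  have htrace : RCLike.re (NormedSpace.exp A).trace = ∑ i, Real.exp (hA.eigenvalues i) := by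
    rw [← cfc_exp_eq_exp hA, hA.cfc_eq, IsHermitian.cfc, Unitary.conjStarAlgAut_apply,
      Matrix.trace_mul_cycle, Unitary.coe_star_mul_self, Matrix.one_mul, trace_diagonal, map_sum]
    exact Finset.sum_congr rfl fun i _ => RCLike.ofReal_re _
  rw [← Algebra.algebraMap_eq_smul_one]
  refine le_algebraMap_of_spectrum_le fun x hx => ?_
  obtain ⟨i, rfl⟩ := hA.spectrum_real_eq_range_eigenvalues ▸ hx
  rw [← Real.exp_le_exp]
  calc Real.exp (hA.eigenvalues i) ≤ ∑ j, Real.exp (hA.eigenvalues j) :=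
        Finset.single_le_sum (fun j _ => (Real.exp_pos _).le) (Finset.mem_univ i)
    _ ≤ Real.exp c := htrace ▸ h

theorem re_trace_exp_sum_le {N : ℕ → Matrix n n 𝕜} {T : ℕ} (hN : ∀ t < T, (N t).IsHermitian)
    (hloss : ∀ t < T,
      RCLike.re (N t * NormedSpace.exp (∑ s ∈ Finset.range t, N s)).trace ≤ 0) :
    RCLike.re (NormedSpace.exp (∑ t ∈ Finset.range T, N t)).trace ≤
      Real.exp (∑ t ∈ Finset.range T, ‖N t‖ ^ 2) * Fintype.card n := by
  induction T with
  | zero => simp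
  | succ T ih =>
    have hlt : ∀ t < T, t < T + 1 := fun t ht => ht.trans T.lt_succ_self
    have hT := T.lt_succ_self
    have hsum : (∑ t ∈ Finset.range T, N t).IsHermitian :=
      isSelfAdjoint_sum _ fun t ht => hN t (hlt t (Finset.mem_range.1 ht))
    rw [Finset.sum_range_succ, Finset.sum_range_succ, add_comm (∑ _ ∈ _, _ ^ 2), Real.exp_add,
      mul_assoc]
    refine (re_trace_exp_add_le hsum (hN T hT) (hloss T hT)).trans ?_
    gcongr
    exact ih (fun t ht => hN t (hlt t ht)) fun t ht => hloss t (hlt t ht)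

theorem sum_le_log_card_add_sum_norm_sq_smul_one [Nonempty n] {N : ℕ → Matrix n n 𝕜} {T : ℕ}
    (hN : ∀ t < T, (N t).IsHermitian)
    (hloss : ∀ t < T,
      RCLike.re (N t * NormedSpace.exp (∑ s ∈ Finset.range t, N s)).trace ≤ 0) :
    ∑ t ∈ Finset.range T, N t ≤
      (Real.log (Fintype.card n) + ∑ t ∈ Finset.range T, ‖N t‖ ^ 2) • (1 : Matrix n n 𝕜) := by
  refine le_smul_one_of_re_trace_exp_le
    (isSelfAdjoint_sum _ fun t ht => hN t (Finset.mem_range.1 ht))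
    ((re_trace_exp_sum_le hN hloss).trans_eq ?_)
  rw [Real.exp_add, Real.exp_log (Nat.cast_pos.2 Fintype.card_pos), mul_comm]

end MultiplicativeWeights

section Bullet

open scoped MatrixOrder

variable {V : Type*} [Fintype V]

theorem bullet_add_left (A B X : Matrix V V ℝ) : bullet (A + B) X = bullet A X + bullet B X := by
  rw [bullet, transpose_add, Matrix.add_mul, trace_add, bullet, bullet]

theorem bullet_sub_left (A B X : Matrix V V ℝ) : bullet (A - B) X = bullet A X - bullet B X := by
  rw [bullet, transpose_sub, Matrix.sub_mul, trace_sub, bullet, bullet]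

theorem bullet_smul_left (c : ℝ) (A X : Matrix V V ℝ) : bullet (c • A) X = c * bullet A X := by
  rw [bullet, transpose_smul, smul_mul_assoc, trace_smul, smul_eq_mul, bullet]

theorem bullet_smul_right (c : ℝ) (A X : Matrix V V ℝ) : bullet A (c • X) = c * bullet A X := by
  rw [bullet, mul_smul_comm, trace_smul, smul_eq_mul, bullet]

theorem bullet_sum_left {ι : Type*} (s : Finset ι) (A : ι → Matrix V V ℝ) (X : Matrix V V ℝ) :
    bullet (∑ i ∈ s, A i) X = ∑ i ∈ s, bullet (A i) X := by
  simp only [bullet, transpose_sum, Finset.sum_mul, trace_sum]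

theorem bullet_mono_left {A B X : Matrix V V ℝ} (hAB : A ≤ B) (hX : 0 ≤ X) :
    bullet A X ≤ bullet B X := by
  have hsymm : (B - A)ᵀ = B - A := (le_iff.1 hAB).isHermitian
  have h := re_trace_mul_nonneg (sub_nonneg.2 hAB) hX
  rw [← sub_nonneg, ← bullet_sub_left, bullet, hsymm]
  exact h

variable [DecidableEq V]

theorem bullet_sqDistMatrix_eq_dotProduct (i j : V) (X : Matrix V V ℝ) :
    bullet (sqDistMatrix i j) X =
      (Pi.single i 1 - Pi.single j 1) ⬝ᵥ X *ᵥ (Pi.single i 1 - Pi.single j 1) := by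
  rw [bullet, sqDistMatrix, transpose_vecMulVec, vecMulVec_mul, trace_vecMulVec, dotProduct_comm,
    ← dotProduct_mulVec]

theorem bullet_demandMatrix (ω : V → ℝ) (X : Matrix V V ℝ) :
    bullet (demandMatrix ω) X =
      (1 / 2) * ∑ i, ∑ j, ω i * ω j * bullet (sqDistMatrix i j) X := by
  simp only [demandMatrix, bullet_smul_left, bullet_sum_left]

theorem bullet_sqDistMatrix_pos {X : Matrix V V ℝ} (hX : X.PosDef) {i j : V} (hij : i ≠ j) :
    0 < bullet (sqDistMatrix i j) X := by
  rw [bullet_sqDistMatrix_eq_dotProduct]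
  refine hX.dotProduct_mulVec_pos fun h => ?_
  simpa [hij] using congrFun h i

theorem bullet_demandMatrix_pos [Nontrivial V] {ω : V → ℝ} (hω : ∀ i, 0 < ω i)
    {X : Matrix V V ℝ} (hX : X.PosDef) : 0 < bullet (demandMatrix ω) X := by
  have hnonneg (i j : V) : 0 ≤ ω i * ω j * bullet (sqDistMatrix i j) X := by
    refine mul_nonneg (mul_pos (hω i) (hω j)).le ?_
    rw [bullet_sqDistMatrix_eq_dotProduct]
    exact hX.posSemidef.dotProduct_mulVec_nonneg _
  obtain ⟨i, j, hij⟩ := exists_pair_ne V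
  rw [bullet_demandMatrix]
  refine mul_pos one_half_pos (Finset.sum_pos' (fun a _ => Finset.sum_nonneg fun b _ => hnonneg a b)
    ⟨i, Finset.mem_univ i, Finset.sum_pos' (fun b _ => hnonneg i b) ⟨j, Finset.mem_univ j, ?_⟩⟩)
  exact mul_pos (mul_pos (hω i) (hω j)) (bullet_sqDistMatrix_pos hX hij)

theorem PrimalFeasible.nontrivial {ω : V → ℝ} {X : Matrix V V ℝ} (hX : PrimalFeasible ω X) :
    Nontrivial V := by
  by_contra hV
  rw [not_nontrivial_iff_subsingleton] at hV
  have hzero (i j : V) : bullet (sqDistMatrix i j) X = 0 := by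
    rw [bullet_sqDistMatrix_eq_dotProduct, Subsingleton.elim i j, sub_self, zero_dotProduct]
  simpa [bullet_demandMatrix, hzero] using hX.sum_one

end Bullet

section TranslationInvariant

open scoped MatrixOrder

/-- The symmetric matrices that annihilate the all-ones vector, that is, the quadratic forms on
`V → ℝ` that are invariant under adding a constant to all coordinates. -/
def translationInvariantForms (V : Type*) [Fintype V] : Submodule ℝ (Matrix V V ℝ) where
  carrier := {A | A.IsSymm ∧ A *ᵥ 1 = 0}
  add_mem' hA hB := ⟨hA.1.add hB.1, by rw [add_mulVec, hA.2, hB.2, add_zero]⟩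
  zero_mem' := ⟨isSymm_zero, zero_mulVec 1⟩
  smul_mem' c A hA := ⟨hA.1.smul c, by rw [smul_mulVec, hA.2, smul_zero]⟩

variable {V : Type*} [Fintype V]

theorem dotProduct_mulVec_sub_const {A : Matrix V V ℝ} (hA : A ∈ translationInvariantForms V)
    (x : V → ℝ) (m : ℝ) : (x - m • 1) ⬝ᵥ A *ᵥ (x - m • 1) = x ⬝ᵥ A *ᵥ x := by
  have hone : (1 : V → ℝ) ⬝ᵥ A *ᵥ x = 0 := by
    rw [dotProduct_mulVec, ← mulVec_transpose, hA.1.eq, hA.2, zero_dotProduct]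
  rw [mulVec_sub, mulVec_smul, hA.2, smul_zero, sub_zero, sub_dotProduct, smul_dotProduct, hone,
    smul_zero, sub_zero]

variable [DecidableEq V]

theorem sqDistMatrix_mem_translationInvariantForms (i j : V) :
    sqDistMatrix i j ∈ translationInvariantForms V := by
  refine ⟨transpose_vecMulVec _ _, ?_⟩
  simp [sqDistMatrix, vecMulVec_mulVec, sub_dotProduct]

theorem triMatrix_mem_translationInvariantForms (p : Triple V) :
    triMatrix p ∈ translationInvariantForms V := by
  obtain ⟨⟨q, j⟩, hp⟩ := p
  induction q with
  | h i k =>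
    exact sub_mem (add_mem (sqDistMatrix_mem_translationInvariantForms i j)
      (sqDistMatrix_mem_translationInvariantForms j k))
      (sqDistMatrix_mem_translationInvariantForms i k)

theorem demandMatrix_mem_translationInvariantForms (ω : V → ℝ) :
    demandMatrix ω ∈ translationInvariantForms V :=
  Submodule.smul_mem _ _ (sum_mem fun i _ => sum_mem fun j _ =>
    Submodule.smul_mem _ _ (sqDistMatrix_mem_translationInvariantForms i j))

theorem dotProduct_demandMatrix_mulVec (ω x : V → ℝ) :
    x ⬝ᵥ demandMatrix ω *ᵥ x = (∑ i, ω i) * ∑ i, ω i * x i ^ 2 - (ω ⬝ᵥ x) ^ 2 := by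
  have hsq (i j : V) : x ⬝ᵥ sqDistMatrix i j *ᵥ x = (x i - x j) ^ 2 := by
    simp [sqDistMatrix, vecMulVec_mulVec, sub_dotProduct, dotProduct_sub, sq]
  have hrow : ∑ i, ∑ j, ω i * ω j * x i ^ 2 = (∑ i, ω i) * ∑ i, ω i * x i ^ 2 := by
    rw [Finset.sum_comm, Finset.sum_mul_sum]
    exact Finset.sum_congr rfl fun i _ => Finset.sum_congr rfl fun j _ => by ring
  have hcol : ∑ i, ∑ j, ω i * ω j * x j ^ 2 = (∑ i, ω i) * ∑ i, ω i * x i ^ 2 := by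
    rw [Finset.sum_mul_sum]
    exact Finset.sum_congr rfl fun i _ => Finset.sum_congr rfl fun j _ => by ring
  have hcross : ∑ i, ∑ j, ω i * ω j * (x i * x j) = (ω ⬝ᵥ x) ^ 2 := by
    rw [dotProduct, sq, Finset.sum_mul_sum]
    exact Finset.sum_congr rfl fun i _ => Finset.sum_congr rfl fun j _ => by ring
  calc x ⬝ᵥ demandMatrix ω *ᵥ x = 1 / 2 * ∑ i, ∑ j, ω i * ω j * (x i - x j) ^ 2 := by
        simp only [demandMatrix, smul_mulVec, sum_mulVec, dotProduct_smul, dotProduct_sum, hsq,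
          smul_eq_mul]
    _ = 1 / 2 * (∑ i, ∑ j, ω i * ω j * x i ^ 2 + ∑ i, ∑ j, ω i * ω j * x j ^ 2 -
          2 * ∑ i, ∑ j, ω i * ω j * (x i * x j)) := by
        simp only [Finset.mul_sum, ← Finset.sum_add_distrib, ← Finset.sum_sub_distrib]
        exact Finset.sum_congr rfl fun i _ => Finset.sum_congr rfl fun j _ => by ring
    _ = (∑ i, ω i) * ∑ i, ω i * x i ^ 2 - (ω ⬝ᵥ x) ^ 2 := by
        rw [hrow, hcol, hcross]
        ring

theorem le_smul_demandMatrix {ω : V → ℝ} (hω : ∀ i, 1 ≤ ω i) {N : Matrix V V ℝ}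
    (hN : N ∈ translationInvariantForms V) {c : ℝ} (hc : 0 ≤ c)
    (hNc : N ≤ c • (1 : Matrix V V ℝ)) : N ≤ (c / ∑ i, ω i) • demandMatrix ω := by
  have hmem : (c / ∑ i, ω i) • demandMatrix ω - N ∈ translationInvariantForms V :=
    sub_mem (Submodule.smul_mem _ _ (demandMatrix_mem_translationInvariantForms ω)) hN
  refine le_iff.2 (.of_dotProduct_mulVec_nonneg hmem.1 fun x => ?_)
  rcases isEmpty_or_nonempty V with hV | hV
  · simp
  have hW : 0 < ∑ i, ω i :=
    Finset.sum_pos (fun i _ => one_pos.trans_le (hω i)) Finset.univ_nonempty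
  -- Shifting by the weighted mean removes the cross term of the demand form.
  set y := x - ((ω ⬝ᵥ x) / ∑ i, ω i) • (1 : V → ℝ) with hy
  have hmean : ω ⬝ᵥ y = 0 := by
    rw [hy, dotProduct_sub, dotProduct_smul, dotProduct_one, smul_eq_mul, div_mul_cancel₀ _ hW.ne',
      sub_self]
  have hNy : y ⬝ᵥ N *ᵥ y ≤ c * ∑ i, y i ^ 2 := by
    have h := (le_iff.1 hNc).dotProduct_mulVec_nonneg y
    rw [sub_mulVec, smul_mulVec, one_mulVec, dotProduct_sub, dotProduct_smul] at h
    simpa [dotProduct, sq] using h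
  have hKy : c * ∑ i, y i ^ 2 ≤ (c / ∑ i, ω i) * (y ⬝ᵥ demandMatrix ω *ᵥ y) := by
    rw [dotProduct_demandMatrix_mulVec, hmean, zero_pow two_ne_zero, sub_zero, ← mul_assoc,
      div_mul_cancel₀ _ hW.ne']
    gcongr with i
    exact le_mul_of_one_le_left (sq_nonneg _) (hω i)
  rw [star_trivial, ← dotProduct_mulVec_sub_const hmem x _, ← hy, sub_mulVec, smul_mulVec,
    dotProduct_sub, dotProduct_smul, smul_eq_mul, sub_nonneg]
  exact hNy.trans hKy

theorem bullet_le_div_of_le_smul_one {ω : V → ℝ} (hω : ∀ i, 1 ≤ ω i) {N : Matrix V V ℝ}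
    (hN : N ∈ translationInvariantForms V) {c : ℝ} (hc : 0 ≤ c)
    (hNc : N ≤ c • (1 : Matrix V V ℝ)) {X : Matrix V V ℝ} (hX : PrimalFeasible ω X) :
    bullet N X ≤ c / ∑ i, ω i := by
  have h := bullet_mono_left (le_smul_demandMatrix hω hN hc hNc)
    (nonneg_iff_posSemidef.2 hX.posSemidef)
  rwa [bullet_smul_left, hX.sum_one, mul_one] at h

end TranslationInvariant

section Algorithm

open scoped MatrixOrder Matrix.Norms.L2Operator

variable {V E : Type*} [Fintype V] [DecidableEq V] [Fintype E]
  {H : DirectedHypergraph V E} {ω : V → ℝ} {o : V} {α ρ η : ℝ} {T : ℕ} {D : ℕ → DualSolution V}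

theorem weightMatrix_eq_exp_sum_slack (ω : V → ℝ) (ρ η : ℝ) (D : ℕ → DualSolution V) (t : ℕ) :
    weightMatrix ω ρ η D t =
      NormedSpace.exp (∑ s ∈ Finset.range t, (η / ρ) • (D s).slack ω) := by
  rw [weightMatrix, Finset.smul_sum, ← Finset.sum_neg_distrib]
  simp only [lossMatrix, smul_smul, ← neg_smul, mul_neg, neg_neg, mul_one_div]

namespace DirectedHypergraph

theorem SDPFeasible.objective_inducedDist_le {X : Matrix V V ℝ} {d : E → ℝ}
    (h : H.SDPFeasible ω o X d) : H.objective (H.inducedDist o X) ≤ H.objective d := by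
  have hdist (e : E) : H.inducedDist o X e ≤ d e := by
    refine max_le (h.nonneg e) (Finset.sup'_le _ _ fun q hq => ?_)
    rw [Finset.mem_product] at hq
    exact sub_nonneg.1 (h.dist_le e q.1 hq.1 q.2 hq.2)
  exact mul_le_mul_of_nonneg_left
    (Finset.sum_le_sum fun e _ => mul_le_mul_of_nonneg_left (hdist e) (H.w_nonneg e))
    one_half_pos.le

namespace GoodDual

theorem slack_mem_translationInvariantForms {X : Matrix V V ℝ} {S : DualSolution V}
    (hS : H.GoodDual ω o α ρ X S) : S.slack ω ∈ translationInvariantForms V :=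
  sub_mem (add_mem
    (sum_mem fun p _ => Submodule.smul_mem _ _ (triMatrix_mem_translationInvariantForms p))
    (Submodule.smul_mem _ _ (demandMatrix_mem_translationInvariantForms ω)))
    ⟨hS.F_symm, hS.F_ones 1 (Submodule.mem_span_singleton_self 1)⟩

theorem isHermitian_slack {X : Matrix V V ℝ} {S : DualSolution V}
    (hS : H.GoodDual ω o α ρ X S) : (S.slack ω).IsHermitian :=
  hS.slack_mem_translationInvariantForms.1

theorem sub_objective_le_bullet_slack {X Y : Matrix V V ℝ} {S : DualSolution V}
    (hS : H.GoodDual ω o α ρ Y S) {d : E → ℝ} (h : H.SDPFeasible ω o X d) :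
    α - H.objective d ≤ bullet (S.slack ω) X := by
  have htri : 0 ≤ ∑ p, S.f p * bullet (triMatrix p) X :=
    Finset.sum_nonneg fun p _ => mul_nonneg (hS.f_nonneg p) (h.primal.triangle p)
  have hF : bullet S.F X ≤ H.objective d :=
    (hS.F_le X h.primal).trans h.objective_inducedDist_le
  simp only [DualSolution.slack, bullet_sub_left, bullet_add_left, bullet_sum_left,
    bullet_smul_left, h.primal.sum_one]
  linarith [hS.z_ge]

theorem norm_smul_slack_le {X : Matrix V V ℝ} {S : DualSolution V} (hS : H.GoodDual ω o α ρ X S)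
    (hρ : 0 < ρ) (hη : 0 ≤ η) : ‖(η / ρ) • S.slack ω‖ ≤ η := by
  have hnorm : ‖S.slack ω‖ ≤ ρ := hS.norm_le
  rw [norm_smul, Real.norm_of_nonneg (by positivity)]
  calc η / ρ * ‖S.slack ω‖ ≤ η / ρ * ρ := by gcongr
    _ = η := div_mul_cancel₀ η hρ.ne'

end GoodDual

end DirectedHypergraph

theorem posDef_weightMatrix {t : ℕ} (hD : ∀ s < t, ((D s).slack ω).IsHermitian) :
    (weightMatrix ω ρ η D t).PosDef := by
  rw [weightMatrix_eq_exp_sum_slack]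
  exact posDef_exp (isSelfAdjoint_sum _ fun s hs =>
    IsHermitian.smul (hD s (Finset.mem_range.1 hs)) (.all (η / ρ)))

theorem IsSubsetFreeRun.goodDual [Nontrivial V] {κ C : ℝ} {O : Oracle V}
    (hD : IsSubsetFreeRun ω ρ O T D) (hO : H.HasWidth ω o κ C α ρ O) (hω : ∀ i, 0 < ω i)
    (t : ℕ) (ht : t < T) :
    H.GoodDual ω o α ρ (primalCandidate ω ρ (stepSize V T) D t) (D t) := by
  induction t using Nat.strong_induction_on with
  | _ t ih =>
    have hW : (weightMatrix ω ρ (stepSize V T) D t).PosDef :=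
      posDef_weightMatrix fun s hs => (ih s hs (hs.trans ht)).isHermitian_slack
    have hpos := bullet_demandMatrix_pos hω hW
    refine (hO _ (hW.posSemidef.smul (inv_nonneg.2 hpos.le)) ?_).2.2 _ (hD t ht)
    rw [bullet_smul_right, inv_mul_cancel₀ hpos.ne']

namespace DirectedHypergraph

theorem GoodDual.trace_slack_mul_weightMatrix_nonpos [Nontrivial V] (hω : ∀ i, 0 < ω i) {t : ℕ}
    (hD : ∀ s ≤ t, H.GoodDual ω o α ρ (primalCandidate ω ρ η D s) (D s)) :
    ((D t).slack ω * weightMatrix ω ρ η D t).trace ≤ 0 := by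
  have hpos : 0 < bullet (demandMatrix ω) (weightMatrix ω ρ η D t) :=
    bullet_demandMatrix_pos hω (posDef_weightMatrix fun s hs => (hD s hs.le).isHermitian_slack)
  have hslack : bullet ((D t).slack ω) (primalCandidate ω ρ η D t) ≤ 0 := by
    rw [DualSolution.slack, bullet_sub_left, sub_nonpos]
    exact (hD t le_rfl).bullet_le
  rw [primalCandidate, bullet_smul_right] at hslack
  have hsymm := (hD t le_rfl).slack_mem_translationInvariantForms.1.eq
  simpa only [bullet, hsymm] using nonpos_of_mul_nonpos_right hslack (inv_pos.2 hpos)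

theorem GoodDual.sum_smul_slack_le_smul_one [Nontrivial V] (hω : ∀ i, 0 < ω i) (hρ : 0 < ρ)
    (hη : 0 ≤ η) (hD : ∀ t < T, H.GoodDual ω o α ρ (primalCandidate ω ρ η D t) (D t)) :
    ∑ t ∈ Finset.range T, (η / ρ) • (D t).slack ω ≤
      (Real.log (Fintype.card V) + T * η ^ 2) • (1 : Matrix V V ℝ) := by
  have hnorm : ∑ t ∈ Finset.range T, ‖(η / ρ) • (D t).slack ω‖ ^ 2 ≤ T * η ^ 2 := by
    simpa only [Finset.card_range, nsmul_eq_mul] using Finset.sum_le_card_nsmul _ _ _ fun t ht =>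
      pow_le_pow_left₀ (norm_nonneg _) ((hD t (Finset.mem_range.1 ht)).norm_smul_slack_le hρ hη) 2
  have hloss (t : ℕ) (ht : t < T) : RCLike.re ((η / ρ) • (D t).slack ω *
      NormedSpace.exp (∑ s ∈ Finset.range t, (η / ρ) • (D s).slack ω)).trace ≤ 0 := by
    rw [← weightMatrix_eq_exp_sum_slack, smul_mul_assoc, trace_smul]
    exact mul_nonpos_of_nonneg_of_nonpos (by positivity)
      (trace_slack_mul_weightMatrix_nonpos hω fun s hs => hD s (hs.trans_lt ht))
  refine (sum_le_log_card_add_sum_norm_sq_smul_one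
    (fun t ht => (hD t ht).isHermitian_slack.smul (.all _)) hloss).trans ?_
  gcongr

theorem SDPFeasible.sub_objective_le {X : Matrix V V ℝ} {d : E → ℝ} (h : H.SDPFeasible ω o X d)
    (hω : ∀ i, 1 ≤ ω i) (hρ : 0 < ρ) (hη : 0 < η) (hT : 0 < T)
    (hD : ∀ t < T, H.GoodDual ω o α ρ (primalCandidate ω ρ η D t) (D t)) :
    α - H.objective d ≤ ρ * (Real.log (Fintype.card V) / (η * T) + η) / ∑ i, ω i := by
  have := h.primal.nontrivial
  have hωpos (i : V) : 0 < ω i := one_pos.trans_le (hω i)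
  have hW : 0 < ∑ i, ω i := Finset.sum_pos (fun i _ => hωpos i) Finset.univ_nonempty
  have hlower : T * (η / ρ * (α - H.objective d)) ≤
      bullet (∑ t ∈ Finset.range T, (η / ρ) • (D t).slack ω) X := by
    have hslack : ∀ t ∈ Finset.range T,
        η / ρ * (α - H.objective d) ≤ bullet ((η / ρ) • (D t).slack ω) X := fun t ht => by
      rw [bullet_smul_left]
      gcongr
      exact (hD t (Finset.mem_range.1 ht)).sub_objective_le_bullet_slack h
    simpa only [bullet_sum_left, Finset.card_range, nsmul_eq_mul] using
      Finset.card_nsmul_le_sum _ _ _ hslack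
  have hupper : bullet (∑ t ∈ Finset.range T, (η / ρ) • (D t).slack ω) X ≤
      (Real.log (Fintype.card V) + T * η ^ 2) / ∑ i, ω i :=
    bullet_le_div_of_le_smul_one hω (sum_mem fun t ht => Submodule.smul_mem _ _
      (hD t (Finset.mem_range.1 ht)).slack_mem_translationInvariantForms)
      (add_nonneg (Real.log_natCast_nonneg _) (by positivity))
      (GoodDual.sum_smul_slack_le_smul_one hωpos hρ hη.le hD) h.primal
  refine le_of_mul_le_mul_left ?_ (by positivity : 0 < T * (η / ρ))
  calc T * (η / ρ) * (α - H.objective d) ≤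
        (Real.log (Fintype.card V) + T * η ^ 2) / ∑ i, ω i := by
        rw [mul_assoc]
        exact hlower.trans hupper
    _ = T * (η / ρ) * (ρ * (Real.log (Fintype.card V) / (η * T) + η) / ∑ i, ω i) := by
        field_simp

end DirectedHypergraph

end Algorithm

section StepSize

variable {V : Type*} [Fintype V]

theorem stepSize_sq_mul {T : ℕ} (hT : 0 < T) :
    stepSize V T ^ 2 * T = Real.log (Fintype.card V) := by
  rw [stepSize, Real.sq_sqrt (div_nonneg (Real.log_natCast_nonneg _) (Nat.cast_nonneg T)),
    div_mul_cancel₀ _ (Nat.cast_ne_zero.2 hT.ne')]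

theorem log_card_pos [Nontrivial V] : 0 < Real.log (Fintype.card V) :=
  Real.log_pos (Nat.one_lt_cast.2 Fintype.one_lt_card)

theorem stepSize_pos [Nontrivial V] {T : ℕ} (hT : 0 < T) : 0 < stepSize V T :=
  Real.sqrt_pos.2 (div_pos log_card_pos (Nat.cast_pos.2 hT))

theorem IsSkewed.sum_le {ω : V → ℝ} {κ : ℝ} (hω : IsSkewed κ ω) :
    ∑ i, ω i ≤ κ * Fintype.card V := by
  simpa [mul_comm] using Finset.sum_le_card_nsmul Finset.univ ω κ fun i _ => (hω i).2

variable [Nontrivial V] {ω : V → ℝ} {κ α ρ : ℝ}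

theorem IsSkewed.sum_pos (hω : IsSkewed κ ω) : 0 < ∑ i, ω i :=
  Finset.sum_pos (fun i _ => one_pos.trans_le (hω i).1) Finset.univ_nonempty

theorem numIter_pos (hω : IsSkewed κ ω) (hα : 0 < α) (hρ : 0 < ρ) : 0 < numIter ω κ α ρ := by
  have hW := hω.sum_pos
  have hκ : 0 < κ := pos_of_mul_pos_left (hW.trans_le hω.sum_le) (Nat.cast_nonneg _)
  have : 0 < Fintype.card V := Fintype.card_pos
  have := log_card_pos (V := V)
  exact Nat.ceil_pos.2 (by positivity)

theorem mul_stepSize_numIter_le (hω : IsSkewed κ ω) (hα : 0 < α) (hρ : 0 < ρ) :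
    4 * ρ * stepSize V (numIter ω κ α ρ) ≤ α * ∑ i, ω i := by
  have hW := hω.sum_pos
  have hT : (0 : ℝ) < numIter ω κ α ρ := Nat.cast_pos.2 (numIter_pos hω hα hρ)
  have := log_card_pos (V := V)
  have hceil : 16 * κ ^ 2 * ρ ^ 2 * (Fintype.card V : ℝ) ^ 2 * Real.log (Fintype.card V) ≤
      numIter ω κ α ρ * (α ^ 2 * (∑ i, ω i) ^ 4) :=
    (div_le_iff₀ (by positivity)).1 (Nat.le_ceil _)
  refine (pow_le_pow_iff_left₀ (mul_nonneg (by positivity) (Real.sqrt_nonneg _))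
    (by positivity) two_ne_zero).1 ?_
  refine le_of_mul_le_mul_left ?_ (by positivity : 0 < numIter ω κ α ρ * (∑ i, ω i) ^ 2)
  calc numIter ω κ α ρ * (∑ i, ω i) ^ 2 * (4 * ρ * stepSize V (numIter ω κ α ρ)) ^ 2
      = 16 * ρ ^ 2 * (∑ i, ω i) ^ 2 *
          (stepSize V (numIter ω κ α ρ) ^ 2 * numIter ω κ α ρ) := by ring
    _ = 16 * ρ ^ 2 * (∑ i, ω i) ^ 2 * Real.log (Fintype.card V) := by
        rw [stepSize_sq_mul (numIter_pos hω hα hρ)]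
    _ ≤ 16 * ρ ^ 2 * (κ * Fintype.card V) ^ 2 * Real.log (Fintype.card V) := by
        gcongr
        exact hω.sum_le
    _ ≤ numIter ω κ α ρ * (α ^ 2 * (∑ i, ω i) ^ 4) := by linarith
    _ = numIter ω κ α ρ * (∑ i, ω i) ^ 2 * (α * ∑ i, ω i) ^ 2 := by ring

theorem mul_log_div_add_stepSize_numIter_le (hω : IsSkewed κ ω) (hα : 0 < α) (hρ : 0 < ρ) :
    ρ * (Real.log (Fintype.card V) / (stepSize V (numIter ω κ α ρ) * numIter ω κ α ρ) +
      stepSize V (numIter ω κ α ρ)) / ∑ i, ω i ≤ α / 2 := by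
  have hT := numIter_pos hω hα hρ
  have hη := stepSize_pos (V := V) hT
  have hT' : (0 : ℝ) < numIter ω κ α ρ := Nat.cast_pos.2 hT
  have hlog : Real.log (Fintype.card V) / (stepSize V (numIter ω κ α ρ) * numIter ω κ α ρ) =
      stepSize V (numIter ω κ α ρ) := by
    rw [← stepSize_sq_mul hT, sq, mul_assoc, mul_div_cancel_right₀ _ (mul_pos hη hT').ne']
  rw [hlog, div_le_iff₀ hω.sum_pos]
  linarith [mul_stepSize_numIter_le hω hα hρ]

end StepSize

end DirSparsestCut

end

theorem mainTheorem5 {V E : Type*} [Fintype V] [DecidableEq V] [Fintype E]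
    (H : DirSparsestCut.DirectedHypergraph V E) (ω : V → ℝ) (κ : ℝ)
    (hω : DirSparsestCut.IsSkewed κ ω) (o : V)
    (α ρ C : ℝ) (hα : 0 < α) (hρ : 0 < ρ)
    (O : DirSparsestCut.Oracle V) (hO : H.HasWidth ω o κ C α ρ O)
    (D : ℕ → DirSparsestCut.DualSolution V)
    (hD : DirSparsestCut.IsSubsetFreeRun ω ρ O (DirSparsestCut.numIter ω κ α ρ) D) :
    ((α / 2 : ℝ) : EReal) ≤ H.sdpValue ω o := by
  refine le_iInf fun X => le_iInf fun d => le_iInf fun h => EReal.coe_le_coe_iff.2 ?_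
  have := h.primal.nontrivial
  have hT := DirSparsestCut.numIter_pos hω hα hρ
  have hη := DirSparsestCut.stepSize_pos (V := V) hT
  have hgood := hD.goodDual hO fun i => one_pos.trans_le (hω i).1
  have hregret := h.sub_objective_le (fun i => (hω i).1) hρ hη hT hgood
  have hhalf := DirSparsestCut.mul_log_div_add_stepSize_numIter_le hω hα hρ
  linarith
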